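/- Let $\mathrm{Nil}$ be the group of matrices $\begin{pmatrix}1&x&z\\0&1&y\\0&0&1\end{pmatrix}$, $x,y,z\in\mathbb R$, with the left invariant metric $dx^2+dy^2+(dz-x\,dy)^2$, whose Levi-Civita connection is $\nabla$, and let $e_1,e_2,e_3$ be the left invariant orthonormal frame equal to $\partial_x,\partial_y,\partial_z$ at the unit; it orients $\mathrm{Nil}$. Let $f:M\to\mathrm{Nil}$ be a smooth immersion of an oriented surface, $N$ its unit normal field compatible with the orientations (so that $\langle N, f_x\times f_y\rangle>0$ in positively oriented coordinates $x,y$ on $M$), and suppose that the mean curvature with respect to $N$ (half of the trace of the second fundamental form) is a constant $H\in\mathbb R$. For a positively oriented conformal parameter $w=x+iy$ on an open subset of $M$ (i.e. the induced metric is $e^{2\alpha}\,dw\,d\bar w$) write $\partial=\frac12(\partial_x-i\partial_y)$, $f^{-1}\partial f=\sum_k Z_k e_k$, and let $$A=\langle\nabla_{\partial f}\,\partial f,\,N\rangle$$ (with $\nabla$ and the metric extended complex bilinearly) be the coefficient of the Hopf differential $A\,dw^2$. Then the quadratic differential $$\widetilde A\,dw^2=\left(A+\frac{Z_3^2}{2H+i}\right)dw^2$$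 is well defined and holomorphic: in every such parameter the function $\widetilde A$ is holomorphic; a change from such a parameter $w$ to another one, $v$, is a holomorphic map, and $\widetilde A^{(w)}=\widetilde A^{(v)}\,(dv/dw)^2$. For every generating spinor $\psi=(\psi_1,\psi_2)$ of the surface, i.e. functions with $Z_1=\frac i2(\bar\psi_2^2+\psi_1^2)$, $Z_2=\frac12(\bar\psi_2^2-\psi_1^2)$, $Z_3=\psi_1\bar\psi_2$, the coefficient is $\widetilde A=A+\frac{(\psi_1\bar\psi_2)^2}{2H+i}$. -/

import Mathlib

open scoped Manifold ContDiff Matrix ComplexConjugate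

/-- The group Nil: `⟨x, y, z⟩` stands for the matrix `!![1, x, z; 0, 1, y; 0, 0, 1]`. -/
@[ext]
structure NilGroup where
  x : ℝ
  y : ℝ
  z : ℝ

namespace NilGroup

def toMatrix (g : NilGroup) : Matrix (Fin 3) (Fin 3) ℝ :=
  !![1, g.x, g.z; 0, 1, g.y; 0, 0, 1]

instance : Mul NilGroup := ⟨fun g h => ⟨g.x + h.x, g.y + h.y, g.z + h.z + g.x * h.y⟩⟩
instance : One NilGroup := ⟨⟨0, 0, 0⟩⟩
instance : Inv NilGroup := ⟨fun g => ⟨-g.x, -g.y, -g.z + g.x * g.y⟩⟩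

@[simp] theorem mul_x (g h : NilGroup) : (g * h).x = g.x + h.x := rfl
@[simp] theorem mul_y (g h : NilGroup) : (g * h).y = g.y + h.y := rfl
@[simp] theorem mul_z (g h : NilGroup) : (g * h).z = g.z + h.z + g.x * h.y := rfl
@[simp] theorem one_x : (1 : NilGroup).x = 0 := rfl
@[simp] theorem one_y : (1 : NilGroup).y = 0 := rfl
@[simp] theorem one_z : (1 : NilGroup).z = 0 := rfl
@[simp] theorem inv_x (g : NilGroup) : g⁻¹.x = -g.x := rfl
@[simp] theorem inv_y (g : NilGroup) : g⁻¹.y = -g.y := rfl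
@[simp] theorem inv_z (g : NilGroup) : g⁻¹.z = -g.z + g.x * g.y := rfl

instance : Group NilGroup where
  mul_assoc a b c := by ext <;> simp <;> ring
  one_mul a := by ext <;> simp
  mul_one a := by ext <;> simp
  inv_mul_cancel a := by ext <;> simp

/-- The group law is multiplication of matrices. -/
theorem toMatrix_mul (g h : NilGroup) : (g * h).toMatrix = g.toMatrix * h.toMatrix := by
  ext i j
  fin_cases i <;> fin_cases j <;>
    simp [toMatrix, Matrix.mul_apply, Fin.sum_univ_three] <;> ring

/-- The global coordinates `(x, y, z)`, which give Nil its smooth structure. -/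
def coords (g : NilGroup) : Fin 3 → ℝ := ![g.x, g.y, g.z]

/-- The basis `e₁, e₂, e₃` (indexed by `0, 1, 2`) of the Lie algebra of Nil. -/
def e : Fin 3 → Matrix (Fin 3) (Fin 3) ℝ :=
  ![!![0, 1, 0; 0, 0, 0; 0, 0, 0], !![0, 0, 0; 0, 0, 1; 0, 0, 0], !![0, 0, 1; 0, 0, 0; 0, 0, 0]]

/-- Components in the basis `e₁, e₂, e₃` of an element of the Lie algebra. -/
def lieCoord (X : Matrix (Fin 3) (Fin 3) ℝ) : Fin 3 → ℝ := ![X 0 1, X 1 2, X 0 2]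

/-- `g⁻¹ · w` in the basis `e₁, e₂, e₃`, where `w = (dx, dy, dz)` is a tangent vector at `g`,
i.e. the matrix `∑ wₖ eₖ`. -/
def leftTrans (g : NilGroup) (w : Fin 3 → ℝ) : Fin 3 → ℝ :=
  lieCoord (g⁻¹.toMatrix * ∑ k, w k • e k)

/-- The left-invariant coframe is `dx, dy, dz - x dy`; the metric `dx² + dy² + (dz - x dy)²` is
therefore the standard dot product of left translated vectors. -/
theorem leftTrans_eq (g : NilGroup) (w : Fin 3 → ℝ) :
    leftTrans g w = ![w 0, w 1, w 2 - g.x * w 1] := by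
  ext i
  fin_cases i <;>
    simp [leftTrans, lieCoord, toMatrix, e, Fin.sum_univ_three, Matrix.mul_apply] <;> ring

/-- `αᵢⱼₖ = ⟨[eᵢ, eⱼ], eₖ⟩`. -/
noncomputable def structConst (i j k : Fin 3) : ℝ := lieCoord ⁅e i, e j⁆ k

/-- `⟨∇_{eₖ} eⱼ, eᵢ⟩` for the Levi-Civita connection of the left-invariant metric in which
`e₁, e₂, e₃` are orthonormal (Koszul formula for a left-invariant orthonormal frame). -/
noncomputable def leviCivita (k j i : Fin 3) : ℝ :=
  (1 / 2) * (structConst k j i + structConst i k j + structConst i j k)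

/-- The connection is torsion free. -/
theorem leviCivita_torsion (k j i : Fin 3) :
    leviCivita k j i - leviCivita j k i = structConst k j i := by
  fin_cases i <;> fin_cases j <;> fin_cases k <;>
    simp [leviCivita, structConst, lieCoord, e, Ring.lie_def] <;> norm_num

/-- The connection is compatible with the metric. -/
theorem leviCivita_metric (k j i : Fin 3) : leviCivita k j i + leviCivita k i j = 0 := by
  fin_cases i <;> fin_cases j <;> fin_cases k <;>
    simp [leviCivita, structConst, lieCoord, e, Ring.lie_def]

/-- The bilinear extension `∑ aₖ bⱼ ∇_{eₖ} eⱼ`, over `ℝ` or complexified. -/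
noncomputable def connection {K : Type*} [RCLike K] (a b : Fin 3 → K) : Fin 3 → K :=
  fun i => ∑ k, ∑ j, a k * b j * ((leviCivita k j i : ℝ) : K)

end NilGroup

/-! ### A map `F` from a domain of the parameter plane `ℂ` to Nil

All vectors along `F` are left translated and written in the basis `e₁, e₂, e₃`.
In the parameter `u = x + i y`, the vectors `1` and `Complex.I` are the directions of `x` and `y`. -/

/-- `F⁻¹ dF(v)` at `u`. -/
noncomputable def leftVelocity (F : ℂ → NilGroup) (u v : ℂ) : Fin 3 → ℝ :=
  (F u).leftTrans (fderiv ℝ (fun t => (F t).coords) u v)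

/-- The covariant derivative `∇_{∂ₐF} ∂_bF` at `u`, for constant directions `a`, `b`. -/
noncomputable def covDeriv (F : ℂ → NilGroup) (u a b : ℂ) : Fin 3 → ℝ :=
  fderiv ℝ (fun t => leftVelocity F t b) u a
    + NilGroup.connection (leftVelocity F u a) (leftVelocity F u b)

/-- The coordinate directions of the parameter plane. -/
noncomputable def coordDir : Fin 2 → ℂ := ![1, Complex.I]

noncomputable def firstFundamentalForm (F : ℂ → NilGroup) (u : ℂ) : Matrix (Fin 2) (Fin 2) ℝ :=
  Matrix.of fun i j => leftVelocity F u (coordDir i) ⬝ᵥ leftVelocity F u (coordDir j)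

/-- Second fundamental form with respect to the normal field `N` along `F`. -/
noncomputable def secondFundamentalForm (F : ℂ → NilGroup) (N : ℂ → Fin 3 → ℝ) (u : ℂ) :
    Matrix (Fin 2) (Fin 2) ℝ :=
  Matrix.of fun i j => covDeriv F u (coordDir i) (coordDir j) ⬝ᵥ N u

/-- The mean curvature: half the trace of the second fundamental form with respect to the first. -/
noncomputable def meanCurvature (F : ℂ → NilGroup) (N : ℂ → Fin 3 → ℝ) (u : ℂ) : ℝ :=
  (1 / 2) * ((firstFundamentalForm F u)⁻¹ * secondFundamentalForm F N u).trace

/-- `∂ = (∂/∂x - i ∂/∂y) / 2`. -/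
noncomputable def wirtinger (h : ℂ → ℂ) (u : ℂ) : ℂ :=
  (1 / 2) * (fderiv ℝ h u 1 - Complex.I * fderiv ℝ h u Complex.I)

/-- The components `Z₁, Z₂, Z₃` (indexed by `0, 1, 2`) of `F⁻¹ ∂F`. -/
noncomputable def zComp (F : ℂ → NilGroup) (u : ℂ) : Fin 3 → ℂ := fun k =>
  (1 / 2) * ((leftVelocity F u 1 k : ℂ) - Complex.I * (leftVelocity F u Complex.I k : ℂ))

/-- The coefficient `A = ⟨∇_{∂F} ∂F, N⟩` of the Hopf differential (complex bilinear extension of the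
connection and of the metric). -/
noncomputable def hopfCoeff (F : ℂ → NilGroup) (N : ℂ → Fin 3 → ℝ) (u : ℂ) : ℂ :=
  ((fun k => wirtinger (fun t => zComp F t k) u)
    + NilGroup.connection (zComp F u) (zComp F u)) ⬝ᵥ (fun k => (N u k : ℂ))

/-- `(ψ₁, ψ₂)` is a generating spinor of `F` on `U`. -/
def IsGeneratingSpinor (F : ℂ → NilGroup) (U : Set ℂ) (ψ₁ ψ₂ : ℂ → ℂ) : Prop :=
  ∀ u ∈ U,
    zComp F u 0 = Complex.I / 2 * (conj (ψ₂ u) ^ 2 + ψ₁ u ^ 2) ∧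
    zComp F u 1 = 1 / 2 * (conj (ψ₂ u) ^ 2 - ψ₁ u ^ 2) ∧
    zComp F u 2 = ψ₁ u * conj (ψ₂ u)

/-- The coefficient `A + Z₃² / (2H + i)`. -/
noncomputable def abreschCoeff (F : ℂ → NilGroup) (N : ℂ → Fin 3 → ℝ) (H : ℝ) (u : ℂ) : ℂ :=
  hopfCoeff F N u + zComp F u 2 ^ 2 / (2 * (H : ℂ) + Complex.I)

/-! ### Surfaces in Nil

`M` is a real smooth surface, with charts in the real plane underlying `ℂ`. -/

section Surfaces

variable {M : Type*} [TopologicalSpace M] [ChartedSpace ℂ M]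

/-- `f` is a smooth immersion into Nil. -/
def IsNilImmersion (f : M → NilGroup) : Prop :=
  ContMDiff 𝓘(ℝ, ℂ) 𝓘(ℝ, Fin 3 → ℝ) ∞ (fun p => (f p).coords) ∧
  ∀ p : M, Function.Injective
    (mfderiv 𝓘(ℝ, ℂ) 𝓘(ℝ, Fin 3 → ℝ) (fun q => (f q).coords) p)

/-- `n` is the left translate `f⁻¹ N` of a continuous unit normal field `N` along `f`. As Nil is
oriented by `e₁, e₂, e₃`, such a field is the same as an orientation of `M`. -/
def IsNilUnitNormal (f : M → NilGroup) (n : M → Fin 3 → ℝ) : Prop :=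
  Continuous n ∧ (∀ p, n p ⬝ᵥ n p = 1) ∧
  ∀ (p : M) (v : TangentSpace 𝓘(ℝ, ℂ) p),
    n p ⬝ᵥ (f p).leftTrans (mfderiv 𝓘(ℝ, ℂ) 𝓘(ℝ, Fin 3 → ℝ) (fun q => (f q).coords) p v) = 0

/-- The mean curvature with respect to `n`, computed in any smooth local coordinates, is
identically `H`. -/
def HasConstMeanCurvature (f : M → NilGroup) (n : M → Fin 3 → ℝ) (H : ℝ) : Prop :=
  ∀ z ∈ IsManifold.maximalAtlas 𝓘(ℝ, ℂ) ∞ M, ∀ u ∈ z.target,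
    meanCurvature (f ∘ z.symm) (n ∘ z.symm) u = H

/-- `z` is a conformal parameter on an open subset of `M`: a smooth chart in which the induced metric
is `exp (2α) dz dz̄`, and which is positively oriented for the orientation defined by `n`. -/
def IsConformalParameter (f : M → NilGroup) (n : M → Fin 3 → ℝ)
    (z : OpenPartialHomeomorph M ℂ) : Prop :=
  z ∈ IsManifold.maximalAtlas 𝓘(ℝ, ℂ) ∞ M ∧
  ∀ u ∈ z.target,
    (∃ α : ℝ, firstFundamentalForm (f ∘ z.symm) u = Real.exp (2 * α) • 1) ∧
    0 < n (z.symm u) ⬝ᵥ crossProduct (leftVelocity (f ∘ z.symm) u 1)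
      (leftVelocity (f ∘ z.symm) u Complex.I)

end Surfaces

/-! ### Algebra of a complexified conformal frame -/

/-! Write Z = f⁻¹∂f, W for its conjugate and E = 2 Z·W for the conformal factor. Torsion-freeness
and conformality make ∇_∂̄ ∂f normal, equal to (HE/2)N, so ∂̄Z is HE/2 · N minus an algebraic
connection term (`wirt_zComp_eq`). Its third component, with Z × W = (i/2)E N, gives ∂̄Z₃ = (E/4)(2H
+ i)N₃, hence ∂̄(Z₃²) = (E/2)(2H + i)N₃Z₃. For constant H the Codazzi equation expresses ∂̄A through
the ambient curvature alone, and in Nil this is −(E/2)N₃Z₃ (`IsConformalFrame.codazzi`,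
`wirt_hopfCoeff`). Dividing Z₃² by 2H + i is exactly what makes the two ∂̄-derivatives cancel.
Transition maps preserve the conformal class and the orientation, so they satisfy the Cauchy–Riemann
equations. Under such a map g, Z picks up the factor g′. Differentiating it in A also produces g″
Z·N, which is zero, so A and Z₃² both scale by (g′)². -/

theorem NilGroup.connection_eq {K : Type*} [RCLike K] (a b : Fin 3 → K) :
    NilGroup.connection a b =
      ![(a 1 * b 2 + a 2 * b 1) / 2, -(a 0 * b 2 + a 2 * b 0) / 2,
        (a 0 * b 1 - a 1 * b 0) / 2] := by
  ext i
  fin_cases i <;>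
    simp [NilGroup.connection, Fin.sum_univ_three, NilGroup.leviCivita, NilGroup.structConst,
      NilGroup.lieCoord, NilGroup.e, Ring.lie_def, map_ofNat (algebraMap ℝ K) 2] <;> ring

/-- `Z, W, N` behave like `∂F`, its conjugate and the unit normal of a conformally parametrized
surface with metric `E |du|²`. -/
structure IsConformalFrame (Z W N : Fin 3 → ℂ) (E : ℂ) : Prop where
  ne_zero : E ≠ 0
  zz : Z ⬝ᵥ Z = 0
  ww : W ⬝ᵥ W = 0
  zw : Z ⬝ᵥ W = E / 2
  nz : N ⬝ᵥ Z = 0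
  nw : N ⬝ᵥ W = 0
  nn : N ⬝ᵥ N = 1

namespace IsConformalFrame

variable {Z W N : Fin 3 → ℂ} {E : ℂ}

/-- Z and W are isotropic, so the coefficient along Z is read off by pairing with W and conversely.
The frame relations say that the matrix with rows Z, W, N has a right inverse; for square matrices
it is also a left inverse, which is the expansion. -/
theorem decomposition (h : IsConformalFrame Z W N E) (D : Fin 3 → ℂ) (i : Fin 3) :
    D i = 2 / E * (D ⬝ᵥ W) * Z i + 2 / E * (D ⬝ᵥ Z) * W i + (D ⬝ᵥ N) * N i := by
  obtain ⟨hE, zz, ww, zw, nz, nw, nn⟩ := h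
  have hPQ : Matrix.of ![Z, W, N] *
      (Matrix.of fun i => ![2 / E * W i, 2 / E * Z i, N i]) = (1 : Matrix (Fin 3) (Fin 3) ℂ) := by
    simp only [Matrix.vec3_dotProduct] at zz ww zw nz nw nn
    have h2 : 2 / E * (E / 2) = 1 := by field_simp
    ext i j
    fin_cases i <;> fin_cases j <;>
      simp [Matrix.mul_apply, Fin.sum_univ_three]
    · linear_combination 2 / E * zw + h2
    · linear_combination 2 / E * zz
    · linear_combination nz
    · linear_combination 2 / E * ww
    · linear_combination 2 / E * zw + h2
    · linear_combination nw
    · linear_combination 2 / E * nw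
    · linear_combination 2 / E * nz
    · linear_combination nn
  have hQP := mul_eq_one_comm.mp hPQ
  have hD : D i = ((1 : Matrix (Fin 3) (Fin 3) ℂ) *ᵥ D) i := by simp
  rw [hD, ← hQP]
  simp [Matrix.mulVec, Matrix.mul_apply, dotProduct, Fin.sum_univ_three]
  ring

/-- The triple product identity Z × (Z × W) = (Z·W)Z − (Z·Z)W reduces to (E/2)Z, while `hc` turns
the left side into (i/2)E (Z × N). -/
theorem cross_normal (h : IsConformalFrame Z W N E)
    (hc : ∀ k, crossProduct Z W k = Complex.I / 2 * E * N k) (k : Fin 3) :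
    crossProduct Z N k = -Complex.I * Z k := by
  obtain ⟨hE, zz, ww, zw, nz, nw, nn⟩ := h
  simp only [Matrix.vec3_dotProduct] at zz ww zw nz nw nn
  have h0 := hc 0
  have h1 := hc 1
  have h2 := hc 2
  simp [cross_apply] at h0 h1 h2
  have hI := Complex.I_mul_I
  apply mul_left_cancel₀ (mul_ne_zero (mul_ne_zero Complex.I_ne_zero (two_ne_zero' ℂ)) hE)
  fin_cases k <;> simp [cross_apply]
  · linear_combination -4 * Z 1 * h2 + 4 * Z 2 * h1 + 4 * Z 0 * zw - 4 * W 0 * zz +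
      2 * E * Z 0 * hI
  · linear_combination -4 * Z 2 * h0 + 4 * Z 0 * h2 + 4 * Z 1 * zw - 4 * W 1 * zz +
      2 * E * Z 1 * hI
  · linear_combination -4 * Z 0 * h1 + 4 * Z 1 * h0 + 4 * Z 2 * zw - 4 * W 2 * zz +
      2 * E * Z 2 * hI

/-- The Codazzi equation in Nil: `P = ∂Z`, `Q = ∂̄Z`, `R = ∂W`, `T = ∂∂̄Z`, `L = ∂N`, `M = ∂̄N`,
`S = ∂E`. -/
theorem codazzi (h : IsConformalFrame Z W N E)
    (hc : ∀ k, crossProduct Z W k = Complex.I / 2 * E * N k)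
    {P Q R T L M : Fin 3 → ℂ} {S H : ℂ}
    (hQ : ∀ k, Q k = H * E / 2 * N k - NilGroup.connection W Z k)
    (hR : ∀ k, R k = H * E / 2 * N k - NilGroup.connection Z W k)
    (hT : ∀ k, T k = H / 2 * (S * N k + E * L k)
      - (NilGroup.connection R Z k + NilGroup.connection W P k))
    (hS : S = 2 * (P ⬝ᵥ W + Z ⬝ᵥ R)) (hPZ : P ⬝ᵥ Z = 0) (hLN : L ⬝ᵥ N = 0) (hMN : M ⬝ᵥ N = 0)
    (hMZ : M ⬝ᵥ Z + N ⬝ᵥ Q = 0) :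
    (T + (NilGroup.connection Q Z + NilGroup.connection Z Q)) ⬝ᵥ N
      + (P + NilGroup.connection Z Z) ⬝ᵥ M = -(E / 2 * N 2 * Z 2) := by
  have hZN := h.cross_normal hc
  set D : Fin 3 → ℂ := P + NilGroup.connection Z Z with hD
  have hdec := h.decomposition D
  obtain ⟨hE, zz, ww, zw, nz, nw, nn⟩ := h
  have hD0 : D 0 = P 0 + Z 1 * Z 2 := by
    simp only [hD, Pi.add_apply, NilGroup.connection_eq, Matrix.cons_val]; ring
  have hD1 : D 1 = P 1 - Z 0 * Z 2 := by
    simp only [hD, Pi.add_apply, NilGroup.connection_eq, Matrix.cons_val]; ring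
  have hD2 : D 2 = P 2 := by
    simp only [hD, Pi.add_apply, NilGroup.connection_eq, Matrix.cons_val]; ring
  simp only [NilGroup.connection_eq, Fin.forall_fin_succ, Fin.succ_zero_eq_one,
    Fin.succ_one_eq_two, IsEmpty.forall_iff, and_true] at hQ hR hT
  simp only [Matrix.cons_val] at hQ hR hT
  obtain ⟨hQ0, hQ1, hQ2⟩ := hQ
  obtain ⟨hR0, hR1, hR2⟩ := hR
  obtain ⟨hT0, hT1, hT2⟩ := hT
  simp only [Matrix.vec3_dotProduct] at *
  -- With D = ∇_∂Z, metric compatibility and normality of ∇_∂W give D·Z = 0 and D·W = S/2. So D =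
  -- (S/E)Z + aN has no W-component, and M·W is never needed.
  have hDZ : D 0 * Z 0 + D 1 * Z 1 + D 2 * Z 2 = 0 := by
    rw [hD0, hD1, hD2]; linear_combination hPZ
  have hDW : D 0 * W 0 + D 1 * W 1 + D 2 * W 2 = S / 2 := by
    rw [hD0, hD1, hD2, hS, hR0, hR1, hR2]
    linear_combination - H * E / 2 * nz
  set a := D 0 * N 0 + D 1 * N 1 + D 2 * N 2 with ha
  simp only [hDZ, hDW] at hdec
  have hdec' : ∀ i, D i = S / E * Z i + a * N i := fun i => by
    rw [hdec i]; ring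
  have hSE : S / E * E = S := by field_simp
  -- This is ⟨D, ∇_∂̄N⟩ = −HS/2; the bracket is D·Γ(W, N), with Γ the connection. The term −HS/2
  -- later cancels the H/2 · S coming from T·N.
  have hDM : D 0 * M 0 + D 1 * M 1 + D 2 * M 2 = - (H * S / 2) -
      (D 0 * ((W 1 * N 2 + W 2 * N 1) / 2) + D 1 * (-(W 0 * N 2 + W 2 * N 0) / 2)
        + D 2 * ((W 0 * N 1 - W 1 * N 0) / 2)) := by
    rw [hdec' 0, hdec' 1, hdec' 2]
    rw [hQ0, hQ1, hQ2] at hMZ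
    linear_combination S / E * hMZ + a * hMN - S / E * (H * E / 2) * nn - H / 2 * hSE
  have hc0 := hc 0
  have hc1 := hc 1
  have hc2 := hc 2
  have hn0 := hZN 0
  have hn1 := hZN 1
  have hn2 := hZN 2
  simp [cross_apply] at hc0 hc1 hc2 hn0 hn1 hn2
  rw [hDM, hD0, hD1, hD2]
  simp [NilGroup.connection_eq]
  rw [hT0, hT1, hT2, hR0, hR1, hR2, hQ0, hQ1, hQ2]
  -- Only the curvature of Nil is left. The weights −3/4, 1/4, 1/4 are the sectional curvatures of
  -- the planes e₁e₂, e₂e₃, e₃e₁. Once Z × W is replaced by (i/2)E N, the isotropic part is a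
  -- multiple of (Z × N)·N = 0, and the third component survives through Z × N = −iZ.
  linear_combination H * S / 2 * nn + H * E / 2 * hLN
    - 3 / 4 * (Z 0 * N 1 - Z 1 * N 0) * hc2 + 1 / 4 * (Z 1 * N 2 - Z 2 * N 1) * hc0
    + 1 / 4 * (Z 2 * N 0 - Z 0 * N 2) * hc1
    - Complex.I / 2 * E * N 2 * hn2 + E / 2 * N 2 * Z 2 * Complex.I_mul_I

end IsConformalFrame

/-! ### Wirtinger operators -/

/-- `(∂/∂x + c ∂/∂y) / 2`; `c = -i` gives `∂` and `c = i` gives `∂̄`. -/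
noncomputable def wirt (c : ℂ) (h : ℂ → ℂ) (u : ℂ) : ℂ :=
  (1 / 2) * (fderiv ℝ h u 1 + c * fderiv ℝ h u Complex.I)

theorem wirtinger_eq_wirt : wirtinger = wirt (-Complex.I) := by
  funext h u
  simp only [wirtinger, wirt]; ring

section wirt

variable {c d : ℂ} {h k : ℂ → ℂ} {u : ℂ}

theorem Filter.EventuallyEq.wirt_eq (e : h =ᶠ[nhds u] k) : wirt c h u = wirt c k u := by
  simp only [wirt, e.fderiv_eq]

theorem wirt_const (a : ℂ) : wirt c (fun _ => a) u = 0 := by simp [wirt]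

theorem wirt_add (hh : DifferentiableAt ℝ h u) (hk : DifferentiableAt ℝ k u) :
    wirt c (fun t => h t + k t) u = wirt c h u + wirt c k u := by
  simp only [wirt, fderiv_fun_add hh hk, _root_.add_apply]; ring

theorem wirt_sub (hh : DifferentiableAt ℝ h u) (hk : DifferentiableAt ℝ k u) :
    wirt c (fun t => h t - k t) u = wirt c h u - wirt c k u := by
  simp only [wirt, fderiv_fun_sub hh hk, _root_.sub_apply]; ring

theorem wirt_mul (hh : DifferentiableAt ℝ h u) (hk : DifferentiableAt ℝ k u) :
    wirt c (fun t => h t * k t) u = wirt c h u * k u + h u * wirt c k u := by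
  simp only [wirt, fderiv_fun_mul hh hk, _root_.add_apply,
    _root_.smul_apply, smul_eq_mul]
  ring

theorem wirt_const_mul (a : ℂ) (hk : DifferentiableAt ℝ k u) :
    wirt c (fun t => a * k t) u = a * wirt c k u := by
  rw [wirt_mul (differentiableAt_const a) hk, wirt_const]; ring

theorem wirt_conj (hh : DifferentiableAt ℝ h u) :
    wirt c (fun t => conj (h t)) u = conj (wirt (conj c) h u) := by
  have h1 : HasFDerivAt (fun t => conj (h t))
      ((Complex.conjCLE : ℂ →L[ℝ] ℂ).comp (fderiv ℝ h u)) u :=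
    (Complex.conjCLE : ℂ →L[ℝ] ℂ).hasFDerivAt.comp u hh.hasFDerivAt
  simp [wirt, h1.fderiv, map_ofNat (starRingEnd ℂ) 2]

theorem contDiffAt_fderiv_apply {E : Type*} [NormedAddCommGroup E] [NormedSpace ℝ E]
    {g : ℂ → E} (hg : ContDiffAt ℝ ∞ g u) (v : ℂ) :
    ContDiffAt ℝ ∞ (fun t => fderiv ℝ g t v) u :=
  (hg.fderiv_right (by simp)).clm_apply contDiffAt_const

theorem ContDiffAt.wirt (hh : ContDiffAt ℝ ∞ h u) : ContDiffAt ℝ ∞ (_root_.wirt c h) u :=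
  contDiffAt_const.mul ((contDiffAt_fderiv_apply hh _).add
    (contDiffAt_const.mul (contDiffAt_fderiv_apply hh _)))

theorem fderiv_fderiv_apply_comm {E : Type*} [NormedAddCommGroup E] [NormedSpace ℝ E]
    {g : ℂ → E} (hg : ContDiffAt ℝ ∞ g u) (v w : ℂ) :
    fderiv ℝ (fun t => fderiv ℝ g t v) u w = fderiv ℝ (fun t => fderiv ℝ g t w) u v := by
  have h2 : DifferentiableAt ℝ (fderiv ℝ g) u :=
    (hg.fderiv_right (m := ∞) (by simp)).differentiableAt (by simp)
  have hs : IsSymmSndFDerivAt ℝ g u := hg.isSymmSndFDerivAt (by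
    simpa using WithTop.coe_le_coe.2 (le_top : (2 : ℕ∞) ≤ ⊤))
  rw [fderiv_clm_apply h2 (differentiableAt_const _), fderiv_clm_apply h2 (differentiableAt_const _)]
  simpa using hs w v

theorem wirt_comm (hh : ContDiffAt ℝ ∞ h u) :
    wirt c (wirt d h) u = wirt d (wirt c h) u := by
  have key (a : ℂ) (v : ℂ) : fderiv ℝ (wirt a h) u v =
      (1 / 2) * (fderiv ℝ (fun t => fderiv ℝ h t 1) u v
        + a * fderiv ℝ (fun t => fderiv ℝ h t Complex.I) u v) := by
    have h1 : DifferentiableAt ℝ (fun t => fderiv ℝ h t 1) u :=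
      (contDiffAt_fderiv_apply hh 1).differentiableAt (by simp)
    have h2 : DifferentiableAt ℝ (fun t => fderiv ℝ h t Complex.I) u :=
      (contDiffAt_fderiv_apply hh _).differentiableAt (by simp)
    have : HasFDerivAt (wirt a h) _ u :=
      ((h1.hasFDerivAt.add (h2.hasFDerivAt.const_mul a)).const_mul (1 / 2 : ℂ))
    rw [this.fderiv]
    simp [mul_add]
  simp only [wirt.eq_1 c (wirt d h), wirt.eq_1 d (wirt c h), key]
  rw [fderiv_fderiv_apply_comm hh Complex.I 1]
  ring

theorem differentiableAt_complex_of_wirt (hh : DifferentiableAt ℝ h u)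
    (h0 : wirt Complex.I h u = 0) : DifferentiableAt ℂ h u := by
  refine differentiableAt_complex_iff_differentiableAt_real.2 ⟨hh, ?_⟩
  simp only [wirt] at h0
  rw [smul_eq_mul]
  linear_combination -2 * Complex.I * h0 + fderiv ℝ h u Complex.I * Complex.I_mul_I

end wirt

theorem wirt_dotProduct {c u : ℂ} {a b : ℂ → Fin 3 → ℂ}
    (ha : ∀ k, DifferentiableAt ℝ (fun t => a t k) u)
    (hb : ∀ k, DifferentiableAt ℝ (fun t => b t k) u) :
    wirt c (fun t => a t ⬝ᵥ b t) u =
      (fun k => wirt c (fun t => a t k) u) ⬝ᵥ b u + a u ⬝ᵥ fun k => wirt c (fun t => b t k) u := by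
  have h (k : Fin 3) := (ha k).fun_mul (hb k)
  simp only [Matrix.vec3_dotProduct]
  rw [wirt_add ((h 0).fun_add (h 1)) (h 2), wirt_add (h 0) (h 1), wirt_mul (ha 0) (hb 0),
    wirt_mul (ha 1) (hb 1), wirt_mul (ha 2) (hb 2)]
  ring

/-! ### Left translated derivatives of a map into Nil -/

section LeftVelocity

variable {F : ℂ → NilGroup} {u : ℂ}

theorem leftVelocity_eq (F : ℂ → NilGroup) (u v : ℂ) :
    leftVelocity F u v = ![fderiv ℝ (fun t => (F t).coords) u v 0,
      fderiv ℝ (fun t => (F t).coords) u v 1,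
      fderiv ℝ (fun t => (F t).coords) u v 2
        - (F u).coords 0 * fderiv ℝ (fun t => (F t).coords) u v 1] := by
  rw [leftVelocity, NilGroup.leftTrans_eq]; rfl

theorem contDiffAt_leftVelocity (hF : ContDiffAt ℝ ∞ (fun t => (F t).coords) u) (v : ℂ) :
    ContDiffAt ℝ ∞ (fun t => leftVelocity F t v) u := by
  have h := contDiffAt_pi.1 (contDiffAt_fderiv_apply hF v)
  have h0 := contDiffAt_pi.1 hF 0
  simp only [leftVelocity_eq]
  refine contDiffAt_pi.2 fun k => ?_
  fin_cases k
  · exact h 0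
  · exact h 1
  · exact (h 2).sub (h0.mul (h 1))

/-- Left translation contributes the product of first derivatives in the last entry. It is not
symmetric in `a` and `v`; its antisymmetric part is what the torsion-free connection compensates. -/
theorem fderiv_leftVelocity (hF : ContDiffAt ℝ ∞ (fun t => (F t).coords) u) (v a : ℂ) :
    fderiv ℝ (fun t => leftVelocity F t v) u a =
      ![fderiv ℝ (fun t => fderiv ℝ (fun s => (F s).coords) t v) u a 0,
        fderiv ℝ (fun t => fderiv ℝ (fun s => (F s).coords) t v) u a 1,
        fderiv ℝ (fun t => fderiv ℝ (fun s => (F s).coords) t v) u a 2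
        - ((F u).coords 0 * fderiv ℝ (fun t => fderiv ℝ (fun s => (F s).coords) t v) u a 1
          + fderiv ℝ (fun t => (F t).coords) u a 0 * fderiv ℝ (fun t => (F t).coords) u v 1)] := by
  have hg := hasFDerivAt_pi'.1
    ((contDiffAt_fderiv_apply hF v).differentiableAt (by simp)).hasFDerivAt
  have hc := hasFDerivAt_pi'.1 (hF.differentiableAt (by simp)).hasFDerivAt
  have hV := hasFDerivAt_pi'.1
    ((contDiffAt_leftVelocity hF v).differentiableAt (by simp)).hasFDerivAt
  simp only [leftVelocity_eq] at hV ⊢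
  ext k
  fin_cases k
  · exact DFunLike.congr_fun ((hV 0).unique (hg 0)) a
  · exact DFunLike.congr_fun ((hV 1).unique (hg 1)) a
  · refine (DFunLike.congr_fun ((hV 2).unique ((hg 2).sub ((hc 0).mul (hg 1)))) a).trans ?_
    simp
    ring

/-- The Levi-Civita connection is torsion free. -/
theorem covDeriv_comm (hF : ContDiffAt ℝ ∞ (fun t => (F t).coords) u) (a b : ℂ) :
    covDeriv F u a b = covDeriv F u b a := by
  have hs := fderiv_fderiv_apply_comm hF b a
  simp only [covDeriv, fderiv_leftVelocity hF, hs]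
  simp only [NilGroup.connection_eq, leftVelocity_eq]
  ext k
  fin_cases k <;> simp <;> ring

/-- The conjugate of `zComp`. -/
noncomputable def zConj (F : ℂ → NilGroup) (u : ℂ) : Fin 3 → ℂ := fun k => conj (zComp F u k)

theorem zConj_apply (F : ℂ → NilGroup) (u : ℂ) (k : Fin 3) :
    zConj F u k = (1 / 2) *
      ((leftVelocity F u 1 k : ℂ) + Complex.I * (leftVelocity F u Complex.I k : ℂ)) := by
  simp [zConj, zComp, map_ofNat (starRingEnd ℂ) 2]

theorem contDiffAt_zComp (hF : ContDiffAt ℝ ∞ (fun t => (F t).coords) u) (k : Fin 3) :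
    ContDiffAt ℝ ∞ (fun t => zComp F t k) u := by
  have h (v : ℂ) : ContDiffAt ℝ ∞ (fun t => ((leftVelocity F t v k : ℝ) : ℂ)) u :=
    Complex.ofRealCLM.contDiff.contDiffAt.comp u (contDiffAt_pi.1 (contDiffAt_leftVelocity hF v) k)
  exact contDiffAt_const.mul ((h 1).sub (contDiffAt_const.mul (h Complex.I)))

theorem contDiffAt_zConj (hF : ContDiffAt ℝ ∞ (fun t => (F t).coords) u) (k : Fin 3) :
    ContDiffAt ℝ ∞ (fun t => zConj F t k) u :=
  Complex.conjCLE.contDiff.contDiffAt.comp u (contDiffAt_zComp hF k)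

theorem fderiv_zComp (hF : ContDiffAt ℝ ∞ (fun t => (F t).coords) u) (k : Fin 3) (a : ℂ) :
    fderiv ℝ (fun t => zComp F t k) u a = (1 / 2) *
      ((fderiv ℝ (fun t => leftVelocity F t 1) u a k : ℂ)
        - Complex.I * (fderiv ℝ (fun t => leftVelocity F t Complex.I) u a k : ℂ)) := by
  have h (v : ℂ) := Complex.ofRealCLM.hasFDerivAt.comp u (hasFDerivAt_pi'.1
    ((contDiffAt_leftVelocity hF v).differentiableAt (by simp)).hasFDerivAt k)
  have hz : HasFDerivAt (fun t => zComp F t k) _ u :=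
    (((h 1).sub ((h Complex.I).const_mul Complex.I)).const_mul (1 / 2 : ℂ))
  rw [hz.fderiv]
  simp [mul_sub]

theorem NilGroup.connection_conj (a b : Fin 3 → ℂ) (k : Fin 3) :
    NilGroup.connection (fun i => conj (a i)) (fun i => conj (b i)) k
      = conj (NilGroup.connection a b k) := by
  fin_cases k <;> simp [NilGroup.connection_eq, map_ofNat (starRingEnd ℂ) 2]

/-- `∇_{∂̄F} ∂F` is a quarter of the (real) tension field of `F`. -/
theorem wirt_zComp (hF : ContDiffAt ℝ ∞ (fun t => (F t).coords) u) (k : Fin 3) :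
    wirt Complex.I (fun t => zComp F t k) u + NilGroup.connection (zConj F u) (zComp F u) k =
      (((1 / 4) * (covDeriv F u 1 1 k + covDeriv F u Complex.I Complex.I k) : ℝ) : ℂ) := by
  -- Expanding (∇ₓ + i∇_y)(F_x − iF_y)/4, the imaginary part is a difference of mixed covariant
  -- derivatives, which vanishes by symmetry.
  have hc : (covDeriv F u 1 Complex.I k : ℂ) = covDeriv F u Complex.I 1 k := by
    rw [covDeriv_comm hF]
  simp only [covDeriv, Pi.add_apply] at hc ⊢
  have h2 := Complex.I_mul_I
  simp only [wirt, fderiv_zComp hF]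
  simp only [NilGroup.connection_eq] at hc ⊢
  fin_cases k <;> simp [zConj_apply, zComp] at hc ⊢
  · linear_combination (-Complex.I / 4) * hc - (1 / 4) *
      (fderiv ℝ (fun t => leftVelocity F t Complex.I) u Complex.I 0
        + (leftVelocity F u Complex.I 1) * leftVelocity F u Complex.I 2) * h2
  · linear_combination (-Complex.I / 4) * hc - (1 / 4) *
      (fderiv ℝ (fun t => leftVelocity F t Complex.I) u Complex.I 1
        - (leftVelocity F u Complex.I 0) * leftVelocity F u Complex.I 2) * h2
  · linear_combination (-Complex.I / 4) * hc - (1 / 4) *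
      (fderiv ℝ (fun t => leftVelocity F t Complex.I) u Complex.I 2) * h2

theorem wirt_zConj (hF : ContDiffAt ℝ ∞ (fun t => (F t).coords) u) (k : Fin 3) :
    wirt (-Complex.I) (fun t => zConj F t k) u + NilGroup.connection (zComp F u) (zConj F u) k =
      (((1 / 4) * (covDeriv F u 1 1 k + covDeriv F u Complex.I Complex.I k) : ℝ) : ℂ) := by
  have h := congrArg conj (wirt_zComp hF k)
  rw [map_add, Complex.conj_ofReal, ← NilGroup.connection_conj] at h
  rw [← h]
  congr 1
  · simpa [zConj] using wirt_conj (c := -Complex.I)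
      ((contDiffAt_zComp hF k).differentiableAt (by simp))
  · simp only [zConj, Complex.conj_conj]
    rfl

end LeftVelocity

/-! ### Conformally parametrized surfaces -/

/-- `F` is a positively oriented conformal parametrization over `U` of an immersed surface in Nil
with unit normal `N`. -/
structure IsConformalParametrization (F : ℂ → NilGroup) (N : ℂ → Fin 3 → ℝ) (U : Set ℂ) :
    Prop where
  isOpen : IsOpen U
  smooth : ContDiffOn ℝ ∞ (fun t => (F t).coords) U
  unit : ∀ u ∈ U, N u ⬝ᵥ N u = 1
  orth : ∀ u ∈ U, ∀ v, N u ⬝ᵥ leftVelocity F u v = 0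
  conf : ∀ u ∈ U, ∃ α : ℝ, firstFundamentalForm F u = Real.exp (2 * α) • 1
  pos : ∀ u ∈ U, 0 < N u ⬝ᵥ crossProduct (leftVelocity F u 1) (leftVelocity F u Complex.I)

namespace IsConformalParametrization

variable {F : ℂ → NilGroup} {N : ℂ → Fin 3 → ℝ} {U : Set ℂ} {u : ℂ}

theorem contDiffAt (h : IsConformalParametrization F N U) (hu : u ∈ U) :
    ContDiffAt ℝ ∞ (fun t => (F t).coords) u :=
  h.smooth.contDiffAt (h.isOpen.mem_nhds hu)

theorem exists_conformal_factor (h : IsConformalParametrization F N U) (hu : u ∈ U) :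
    ∃ e : ℝ, 0 < e ∧ firstFundamentalForm F u = e • 1 ∧
      leftVelocity F u 1 ⬝ᵥ leftVelocity F u 1 = e ∧
      leftVelocity F u Complex.I ⬝ᵥ leftVelocity F u Complex.I = e ∧
      leftVelocity F u 1 ⬝ᵥ leftVelocity F u Complex.I = 0 := by
  obtain ⟨α, hα⟩ := h.conf u hu
  refine ⟨_, Real.exp_pos (2 * α), hα, ?_, ?_, ?_⟩
  · simpa [firstFundamentalForm, coordDir] using congrFun (congrFun hα 0) 0
  · simpa [firstFundamentalForm, coordDir] using congrFun (congrFun hα 1) 1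
  · simpa [firstFundamentalForm, coordDir] using congrFun (congrFun hα 0) 1

/-- The dot products are conformality and orthogonality in complex form. For the cross product, Z ×
W = (i/2) F_x × F_y is normal; Lagrange's identity gives the length e of F_x × F_y and the
orientation fixes its sign. -/
theorem exists_frame (h : IsConformalParametrization F N U) (hu : u ∈ U) :
    ∃ e : ℝ, firstFundamentalForm F u = e • 1 ∧
      IsConformalFrame (zComp F u) (zConj F u) (fun k => (N u k : ℂ)) e ∧
      ∀ k, crossProduct (zComp F u) (zConj F u) k = Complex.I / 2 * e * N u k := by
  obtain ⟨e, he, hI, h11, h22, h12⟩ := h.exists_conformal_factor hu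
  have hN1 := h.orth u hu 1
  have hN2 := h.orth u hu Complex.I
  have hNN := h.unit u hu
  have hpos := h.pos u hu
  set X := leftVelocity F u 1 with hX
  set Y := leftVelocity F u Complex.I with hY
  simp only [Matrix.vec3_dotProduct] at h11 h22 h12 hN1 hN2 hNN
  have h11c := congrArg Complex.ofReal h11
  have h22c := congrArg Complex.ofReal h22
  have h12c := congrArg Complex.ofReal h12
  have hN1c := congrArg Complex.ofReal hN1
  have hN2c := congrArg Complex.ofReal hN2
  have hNNc := congrArg Complex.ofReal hNN
  push_cast at h11c h22c h12c hN1c hN2c hNNc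
  have h2 := Complex.I_mul_I
  have hfr : IsConformalFrame (zComp F u) (zConj F u) (fun k => (N u k : ℂ)) e := by
    refine ⟨by exact_mod_cast he.ne', ?_, ?_, ?_, ?_, ?_, ?_⟩ <;>
      simp only [Matrix.vec3_dotProduct, zConj_apply, zComp, ← hX, ← hY]
    · linear_combination (1 / 4) * h11c - (1 / 4) * h22c - Complex.I / 2 * h12c
        + (1 / 4) * (Y 0 * Y 0 + Y 1 * Y 1 + Y 2 * Y 2) * h2
    · linear_combination (1 / 4) * h11c - (1 / 4) * h22c + Complex.I / 2 * h12c
        + (1 / 4) * (Y 0 * Y 0 + Y 1 * Y 1 + Y 2 * Y 2) * h2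
    · linear_combination (1 / 4) * h11c + (1 / 4) * h22c
        - (1 / 4) * (Y 0 * Y 0 + Y 1 * Y 1 + Y 2 * Y 2) * h2
    · linear_combination (1 / 2) * hN1c - Complex.I / 2 * hN2c
    · linear_combination (1 / 2) * hN1c + Complex.I / 2 * hN2c
    · exact hNNc
  refine ⟨e, hI, hfr, fun k => ?_⟩
  set C := crossProduct X Y with hC
  have hCC : (N u ⬝ᵥ C) ^ 2 = e ^ 2 := by
    have hd (k : Fin 3) : C k = (N u ⬝ᵥ C) * N u k := by
      have := hfr.decomposition (fun k => (C k : ℂ)) k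
      have hz : (fun k => (C k : ℂ)) ⬝ᵥ zComp F u = 0 := by
        simp [Matrix.vec3_dotProduct, zComp, hC, cross_apply, ← hX, ← hY]; ring
      have hw : (fun k => (C k : ℂ)) ⬝ᵥ zConj F u = 0 := by
        simp [Matrix.vec3_dotProduct, zConj_apply, hC, cross_apply, ← hX, ← hY]; ring
      rw [hz, hw] at this
      simp only [Matrix.vec3_dotProduct] at this ⊢
      have h3 : C k = (C 0 * N u 0 + C 1 * N u 1 + C 2 * N u 2) * N u k := by
        apply Complex.ofReal_injective
        push_cast
        linear_combination this
      linear_combination h3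
    have hCe : C ⬝ᵥ C = e * e := by
      simp only [hC, Matrix.vec3_dotProduct, cross_apply, Matrix.cons_val]
      linear_combination e * h11 + (X 0 * X 0 + X 1 * X 1 + X 2 * X 2) * h22
        - (X 0 * Y 0 + X 1 * Y 1 + X 2 * Y 2) * h12
    simp only [Matrix.vec3_dotProduct] at hCe hd ⊢
    have h0 := hd 0
    have h1 := hd 1
    have h2 := hd 2
    set m := N u 0 * C 0 + N u 1 * C 1 + N u 2 * C 2
    rw [h0, h1, h2] at hCe
    linear_combination hCe - m ^ 2 * hNN
  have hCe : N u ⬝ᵥ C = e := (pow_left_inj₀ hpos.le he.le two_ne_zero).1 hCC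
  have hdec := hfr.decomposition (crossProduct (zComp F u) (zConj F u)) k
  have hCec := congrArg Complex.ofReal hCe
  simp only [Matrix.vec3_dotProduct, hC, cross_apply, Matrix.cons_val] at hCec
  push_cast at hCec
  rw [hdec]
  have hz : crossProduct (zComp F u) (zConj F u) ⬝ᵥ zComp F u = 0 := by
    simp only [Matrix.vec3_dotProduct, cross_apply, Matrix.cons_val]; ring
  have hw : crossProduct (zComp F u) (zConj F u) ⬝ᵥ zConj F u = 0 := by
    simp only [Matrix.vec3_dotProduct, cross_apply, Matrix.cons_val]; ring
  have hn : crossProduct (zComp F u) (zConj F u) ⬝ᵥ (fun k => (N u k : ℂ))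
      = Complex.I / 2 * e := by
    simp only [Matrix.vec3_dotProduct, cross_apply, Matrix.cons_val, zComp, zConj_apply, ← hX, ← hY]
    linear_combination Complex.I / 2 * hCec
  rw [hz, hw, hn]
  ring

/-- `∇_{∂̄F} ∂F = H E / 2 · N`. -/
theorem tension_eq (h : IsConformalParametrization F N U) (hu : u ∈ U) {e : ℝ}
    (he : firstFundamentalForm F u = e • 1)
    (hfr : IsConformalFrame (zComp F u) (zConj F u) (fun k => (N u k : ℂ)) e) {H : ℝ}
    (hH : meanCurvature F N u = H)
    (hZ : ∀ t ∈ U, zComp F t ⬝ᵥ zComp F t = 0) (k : Fin 3) :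
    (((1 / 4) * (covDeriv F u 1 1 k + covDeriv F u Complex.I Complex.I k) : ℝ) : ℂ)
      = H * e / 2 * N u k := by
  have hF := h.contDiffAt hu
  have he0 : e ≠ 0 := by exact_mod_cast hfr.ne_zero
  set W : Fin 3 → ℂ := fun k =>
    (((1 / 4) * (covDeriv F u 1 1 k + covDeriv F u Complex.I Complex.I k) : ℝ) : ℂ) with hW
  -- The first fundamental form is e times the identity, so the trace of the second one is 2He; a
  -- quarter of it is the normal component.
  have hWN : W ⬝ᵥ (fun k => (N u k : ℂ)) = H * e / 2 := by
    have hinv : (e • (1 : Matrix (Fin 2) (Fin 2) ℝ))⁻¹ = e⁻¹ • 1 := by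
      apply Matrix.inv_eq_left_inv
      simp [smul_smul, he0]
    rw [meanCurvature, he, hinv] at hH
    have h1 : (covDeriv F u 1 1 ⬝ᵥ N u + covDeriv F u Complex.I Complex.I ⬝ᵥ N u) = 2 * H * e := by
      rw [← hH]
      simp [Matrix.trace_fin_two, secondFundamentalForm, coordDir]
      field_simp
    have h1c := congrArg Complex.ofReal h1
    simp [Matrix.vec3_dotProduct] at h1c
    simp [Matrix.vec3_dotProduct, hW]
    linear_combination (1 / 4) * h1c
  have hd (k : Fin 3) : DifferentiableAt ℝ (fun t => zComp F t k) u :=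
    (contDiffAt_zComp hF k).differentiableAt (by simp)
  -- Tangential components vanish: ∂̄ of Z·Z = 0 handles the pairing with Z, and since the vector
  -- `W` here is real, conjugation handles the other one.
  have hWZ : W ⬝ᵥ zComp F u = 0 := by
    have h0 : wirt Complex.I (fun t => zComp F t ⬝ᵥ zComp F t) u = 0 := by
      rw [Filter.EventuallyEq.wirt_eq (k := fun _ => 0)
        (Filter.eventually_of_mem (h.isOpen.mem_nhds hu) hZ), wirt_const]
    rw [wirt_dotProduct hd hd] at h0
    simp only [Matrix.vec3_dotProduct] at h0
    simp only [hW, ← wirt_zComp hF, Matrix.vec3_dotProduct, NilGroup.connection_eq,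
      Matrix.cons_val]
    linear_combination (1 / 2) * h0
  have hWW : W ⬝ᵥ zConj F u = 0 := by
    have := congrArg conj hWZ
    simp [Matrix.vec3_dotProduct, hW] at this
    simpa [Matrix.vec3_dotProduct, zConj, hW, map_ofNat (starRingEnd ℂ) 4] using this
  change W k = _
  rw [hfr.decomposition W k, hWZ, hWW, hWN]
  ring

end IsConformalParametrization

/-! ### Product rule and smoothness for bilinear expressions. -/

theorem wirt_connection {c u : ℂ} {a b : ℂ → Fin 3 → ℂ}
    (ha : ∀ k, DifferentiableAt ℝ (fun t => a t k) u)
    (hb : ∀ k, DifferentiableAt ℝ (fun t => b t k) u) (k : Fin 3) :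
    wirt c (fun t => NilGroup.connection (a t) (b t) k) u =
      NilGroup.connection (fun k => wirt c (fun t => a t k) u) (b u) k +
        NilGroup.connection (a u) (fun k => wirt c (fun t => b t k) u) k := by
  have hab (i j : Fin 3) := (ha i).fun_mul (hb j)
  simp only [NilGroup.connection_eq]
  fin_cases k
  · simp only [Fin.zero_eta, Matrix.cons_val, div_eq_inv_mul]
    rw [wirt_const_mul _ ((hab 1 2).fun_add (hab 2 1)), wirt_add (hab 1 2) (hab 2 1),
      wirt_mul (ha 1) (hb 2), wirt_mul (ha 2) (hb 1)]
    ring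
  · simp only [Fin.mk_one, Matrix.cons_val, div_eq_inv_mul, mul_neg, ← neg_mul]
    rw [wirt_const_mul _ ((hab 0 2).fun_add (hab 2 0)), wirt_add (hab 0 2) (hab 2 0),
      wirt_mul (ha 0) (hb 2), wirt_mul (ha 2) (hb 0)]
    ring
  · simp only [Fin.reduceFinMk, Matrix.cons_val, div_eq_inv_mul]
    rw [wirt_const_mul _ ((hab 0 1).fun_sub (hab 1 0)), wirt_sub (hab 0 1) (hab 1 0),
      wirt_mul (ha 0) (hb 1), wirt_mul (ha 1) (hb 0)]
    ring

theorem contDiffAt_connection {u : ℂ} {a b : ℂ → Fin 3 → ℂ}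
    (ha : ∀ k, ContDiffAt ℝ ∞ (fun t => a t k) u)
    (hb : ∀ k, ContDiffAt ℝ ∞ (fun t => b t k) u) (k : Fin 3) :
    ContDiffAt ℝ ∞ (fun t => NilGroup.connection (a t) (b t) k) u := by
  have hab (i j : Fin 3) := (ha i).mul (hb j)
  simp only [NilGroup.connection_eq]
  fin_cases k
  · exact ((hab 1 2).add (hab 2 1)).div_const 2
  · exact ((hab 0 2).add (hab 2 0)).neg.div_const 2
  · exact ((hab 0 1).sub (hab 1 0)).div_const 2

theorem contDiffAt_dotProduct {u : ℂ} {a b : ℂ → Fin 3 → ℂ}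
    (ha : ∀ k, ContDiffAt ℝ ∞ (fun t => a t k) u)
    (hb : ∀ k, ContDiffAt ℝ ∞ (fun t => b t k) u) :
    ContDiffAt ℝ ∞ (fun t => a t ⬝ᵥ b t) u :=
  ContDiffAt.sum fun k _ => (ha k).mul (hb k)

/-! ### The Hopf coefficient under constant mean curvature. -/

namespace IsConformalParametrization

variable {F : ℂ → NilGroup} {N : ℂ → Fin 3 → ℝ} {U : Set ℂ} {u : ℂ} {H : ℝ}

/-- The normal field, with complex entries. -/
noncomputable def normalC (N : ℂ → Fin 3 → ℝ) (u : ℂ) : Fin 3 → ℂ := fun k => (N u k : ℂ)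

/-- The conformal factor of the induced metric `E |du|²`. -/
noncomputable def factor (F : ℂ → NilGroup) (u : ℂ) : ℂ := 2 * (zComp F u ⬝ᵥ zConj F u)

/-- The pointwise factor of `exists_frame` is replaced by the function `factor F`, which can be
differentiated. -/
theorem isConformalFrame (h : IsConformalParametrization F N U) (hu : u ∈ U) :
    IsConformalFrame (zComp F u) (zConj F u) (normalC N u) (factor F u) ∧
    (∀ k, crossProduct (zComp F u) (zConj F u) k
      = Complex.I / 2 * factor F u * normalC N u k) ∧
    ∃ e : ℝ, factor F u = e ∧ firstFundamentalForm F u = e • 1 := by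
  obtain ⟨e, he, hfr, hc⟩ := h.exists_frame hu
  have hE : factor F u = e := by rw [factor, hfr.zw]; ring
  rw [hE]
  exact ⟨hfr, hc, e, rfl, he⟩

theorem wirt_zComp_eq (h : IsConformalParametrization F N U) (hu : u ∈ U)
    (hH : meanCurvature F N u = H) (k : Fin 3) :
    wirt Complex.I (fun t => zComp F t k) u =
      H * factor F u / 2 * normalC N u k - NilGroup.connection (zConj F u) (zComp F u) k := by
  obtain ⟨hfr, -, e, hE, he⟩ := h.isConformalFrame hu
  rw [hE] at hfr ⊢
  rw [eq_sub_iff_add_eq, wirt_zComp (h.contDiffAt hu) k]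
  exact h.tension_eq hu he hfr hH (fun t ht => (h.isConformalFrame ht).1.zz) k

theorem wirt_zConj_eq (h : IsConformalParametrization F N U) (hu : u ∈ U)
    (hH : meanCurvature F N u = H) (k : Fin 3) :
    wirt (-Complex.I) (fun t => zConj F t k) u =
      H * factor F u / 2 * normalC N u k - NilGroup.connection (zComp F u) (zConj F u) k := by
  rw [eq_sub_iff_add_eq, wirt_zConj (h.contDiffAt hu) k, ← wirt_zComp (h.contDiffAt hu) k,
    h.wirt_zComp_eq hu hH k]
  ring

theorem contDiffAt_factor (h : IsConformalParametrization F N U) (hu : u ∈ U) :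
    ContDiffAt ℝ ∞ (factor F) u :=
  contDiffAt_const.mul (contDiffAt_dotProduct (contDiffAt_zComp (h.contDiffAt hu))
    (contDiffAt_zConj (h.contDiffAt hu)))

/-- Smoothness of the normal is not part of the data; it follows from N = (Z × W)/((i/2)E). -/
theorem contDiffAt_normalC (h : IsConformalParametrization F N U) (hu : u ∈ U) (k : Fin 3) :
    ContDiffAt ℝ ∞ (fun t => normalC N t k) u := by
  have hZ := contDiffAt_zComp (h.contDiffAt hu)
  have hW := contDiffAt_zConj (h.contDiffAt hu)
  have hX : ContDiffAt ℝ ∞ (fun t => crossProduct (zComp F t) (zConj F t) k) u := by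
    simp only [cross_apply]
    fin_cases k
    · exact ((hZ 1).mul (hW 2)).sub ((hZ 2).mul (hW 1))
    · exact ((hZ 2).mul (hW 0)).sub ((hZ 0).mul (hW 2))
    · exact ((hZ 0).mul (hW 1)).sub ((hZ 1).mul (hW 0))
  have hE := h.contDiffAt_factor hu
  refine (hX.mul ((contDiffAt_const (c := Complex.I / 2)).mul hE |>.inv
    (mul_ne_zero (by simp) (h.isConformalFrame hu).1.ne_zero))).congr_of_eventuallyEq ?_
  filter_upwards [h.isOpen.mem_nhds hu] with t ht
  obtain ⟨hfr, hc, -⟩ := h.isConformalFrame ht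
  have h0 := hfr.ne_zero
  have hI := Complex.I_ne_zero
  rw [hc k, Pi.inv_apply]
  field_simp

theorem wirt_eq_zero (h : IsConformalParametrization F N U) (hu : u ∈ U) {c a : ℂ} {g : ℂ → ℂ}
    (hg : ∀ t ∈ U, g t = a) : wirt c g u = 0 := by
  rw [Filter.EventuallyEq.wirt_eq (k := fun _ => a)
    (Filter.eventually_of_mem (h.isOpen.mem_nhds hu) hg), wirt_const]

theorem hopfCoeff_eq (F : ℂ → NilGroup) (N : ℂ → Fin 3 → ℝ) (t : ℂ) :
    hopfCoeff F N t = (fun k => wirt (-Complex.I) (fun s => zComp F s k) t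
      + NilGroup.connection (zComp F t) (zComp F t) k) ⬝ᵥ normalC N t := by
  rw [hopfCoeff, wirtinger_eq_wirt]; rfl

theorem contDiffAt_hopf_vector (h : IsConformalParametrization F N U) (hu : u ∈ U) (k : Fin 3) :
    ContDiffAt ℝ ∞ (fun t => wirt (-Complex.I) (fun s => zComp F s k) t
      + NilGroup.connection (zComp F t) (zComp F t) k) u := by
  have hZ := contDiffAt_zComp (h.contDiffAt hu)
  exact (hZ k).wirt.add (contDiffAt_connection hZ hZ k)

theorem contDiffAt_hopfCoeff (h : IsConformalParametrization F N U) (hu : u ∈ U) :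
    ContDiffAt ℝ ∞ (hopfCoeff F N) u := by
  rw [funext (hopfCoeff_eq F N)]
  exact contDiffAt_dotProduct (h.contDiffAt_hopf_vector hu) (h.contDiffAt_normalC hu)

/-- `∂̄A = -E N₃ Z₃ / 2` for surfaces of constant mean curvature. -/
theorem wirt_hopfCoeff (h : IsConformalParametrization F N U)
    (hH : ∀ t ∈ U, meanCurvature F N t = H) (hu : u ∈ U) :
    wirt Complex.I (hopfCoeff F N) u = -(factor F u / 2 * normalC N u 2 * zComp F u 2) := by
  have hZ := contDiffAt_zComp (h.contDiffAt hu)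
  have hW := contDiffAt_zConj (h.contDiffAt hu)
  have hE := h.contDiffAt_factor hu
  have hN := h.contDiffAt_normalC hu
  have dZ (k : Fin 3) : DifferentiableAt ℝ _ u := (hZ k).differentiableAt (by simp)
  have dW (k : Fin 3) : DifferentiableAt ℝ _ u := (hW k).differentiableAt (by simp)
  have dN (k : Fin 3) : DifferentiableAt ℝ _ u := (hN k).differentiableAt (by simp)
  have dE : DifferentiableAt ℝ (factor F) u := hE.differentiableAt (by simp)
  have dΓ (k : Fin 3) : DifferentiableAt ℝ _ u :=
    (contDiffAt_connection hZ hZ k).differentiableAt (by simp)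
  have dP (k : Fin 3) : DifferentiableAt ℝ (wirt (-Complex.I) fun s => zComp F s k) u :=
    (hZ k).wirt.differentiableAt (by simp)
  obtain ⟨hfr, hc, -⟩ := h.isConformalFrame hu
  rw [funext (hopfCoeff_eq F N), wirt_dotProduct
    (fun k => (h.contDiffAt_hopf_vector hu k).differentiableAt (by simp)) dN]
  have hD : (fun k => wirt Complex.I (fun t => wirt (-Complex.I) (fun s => zComp F s k) t
      + NilGroup.connection (zComp F t) (zComp F t) k) u) =
      (fun k => wirt Complex.I (wirt (-Complex.I) fun s => zComp F s k) u) +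
        (NilGroup.connection (fun k => wirt Complex.I (fun s => zComp F s k) u) (zComp F u) +
        NilGroup.connection (zComp F u) (fun k => wirt Complex.I (fun s => zComp F s k) u)) := by
    funext k
    rw [wirt_add (dP k) (dΓ k), wirt_connection dZ dZ k]
    rfl
  rw [hD]
  refine hfr.codazzi hc (P := fun k => wirt (-Complex.I) (fun s => zComp F s k) u)
    (R := fun k => wirt (-Complex.I) (fun s => zConj F s k) u)
    (L := fun k => wirt (-Complex.I) (fun s => normalC N s k) u)
    (S := wirt (-Complex.I) (factor F) u) (H := H)
    (h.wirt_zComp_eq hu (hH u hu)) (h.wirt_zConj_eq hu (hH u hu)) (fun k => ?_) ?_ ?_ ?_ ?_ ?_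
  -- After ∂̄ and ∂ are interchanged, the formula for ∂̄Z is differentiated on a neighbourhood.
  -- Constancy of H enters here: no ∂H term appears.
  · have hev : wirt Complex.I (fun s => zComp F s k) =ᶠ[nhds u] fun t =>
        (H / 2) * (factor F t * normalC N t k)
          - NilGroup.connection (zConj F t) (zComp F t) k := by
      filter_upwards [h.isOpen.mem_nhds hu] with t ht
      rw [h.wirt_zComp_eq ht (hH t ht)]
      ring
    rw [wirt_comm (hZ k), hev.wirt_eq, wirt_sub ((dE.fun_mul (dN k)).const_mul _)
      ((contDiffAt_connection hW hZ k).differentiableAt (by simp)),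
      wirt_const_mul _ (dE.fun_mul (dN k)), wirt_mul dE (dN k), wirt_connection dW dZ k]
  · rw [← wirt_dotProduct dZ dW, ← wirt_const_mul _
      ((contDiffAt_dotProduct hZ hW).differentiableAt (by simp))]
    rfl
  · have h0 := h.wirt_eq_zero hu (c := -Complex.I) fun t ht => (h.isConformalFrame ht).1.zz
    rw [wirt_dotProduct dZ dZ, dotProduct_comm (zComp F u)] at h0
    exact add_self_eq_zero.1 h0
  · have h0 := h.wirt_eq_zero hu (c := -Complex.I) fun t ht => (h.isConformalFrame ht).1.nn
    rw [wirt_dotProduct dN dN, dotProduct_comm (normalC N u)] at h0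
    exact add_self_eq_zero.1 h0
  · have h0 := h.wirt_eq_zero hu (c := Complex.I) fun t ht => (h.isConformalFrame ht).1.nn
    rw [wirt_dotProduct dN dN, dotProduct_comm (normalC N u)] at h0
    exact add_self_eq_zero.1 h0
  · have h0 := h.wirt_eq_zero hu (c := Complex.I) fun t ht => (h.isConformalFrame ht).1.nz
    rwa [wirt_dotProduct dN dZ] at h0

/-- The third component of Γ(W, Z) is −(Z × W)₃/2 = −(i/4)E N₃; this is the source of the i in 2H +
i. The ∂̄-derivative of Z₃²/(2H + i) is then the negative of ∂̄A. -/
theorem differentiableOn_abreschCoeff (h : IsConformalParametrization F N U)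
    (hH : ∀ t ∈ U, meanCurvature F N t = H) :
    DifferentiableOn ℂ (abreschCoeff F N H) U := by
  intro u hu
  have hZ := contDiffAt_zComp (h.contDiffAt hu) 2
  have dZ : DifferentiableAt ℝ (fun t => zComp F t 2) u := hZ.differentiableAt (by simp)
  have dA : DifferentiableAt ℝ (hopfCoeff F N) u :=
    (h.contDiffAt_hopfCoeff hu).differentiableAt (by simp)
  have hne : 2 * (H : ℂ) + Complex.I ≠ 0 := fun h0 => by simpa using congrArg Complex.im h0
  have hfun : abreschCoeff F N H = fun t => hopfCoeff F N t
      + (2 * (H : ℂ) + Complex.I)⁻¹ * (zComp F t 2 * zComp F t 2) := by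
    funext t
    rw [abreschCoeff]; ring
  rw [hfun]
  refine (differentiableAt_complex_of_wirt (dA.fun_add ((dZ.fun_mul dZ).const_mul _)) ?_
    ).differentiableWithinAt
  have hc := (h.isConformalFrame hu).2.1 2
  rw [wirt_add dA ((dZ.fun_mul dZ).const_mul _), wirt_const_mul _ (dZ.fun_mul dZ),
    wirt_mul dZ dZ, h.wirt_hopfCoeff hH hu, h.wirt_zComp_eq hu (hH u hu)]
  simp only [cross_apply, NilGroup.connection_eq, Matrix.cons_val] at hc ⊢
  field_simp
  linear_combination 2 * zComp F u 2 * hc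

end IsConformalParametrization

/-! ### Changes of conformal parameter -/

theorem fderiv_apply_mul_add {h : ℂ → ℂ} {u : ℂ} (a : ℂ) :
    fderiv ℝ h u a = a.re * fderiv ℝ h u 1 + a.im * fderiv ℝ h u Complex.I := by
  conv_lhs => rw [show a = a.re • (1 : ℂ) + a.im • Complex.I by
    simp [Complex.re_add_im], map_add, map_smul, map_smul]
  simp

theorem leftVelocity_apply (F : ℂ → NilGroup) (u a : ℂ) (k : Fin 3) :
    leftVelocity F u a k =
      a.re * leftVelocity F u 1 k + a.im * leftVelocity F u Complex.I k := by
  have h : fderiv ℝ (fun t => (F t).coords) u a =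
      a.re • fderiv ℝ (fun t => (F t).coords) u 1
        + a.im • fderiv ℝ (fun t => (F t).coords) u Complex.I := by
    conv_lhs => rw [show a = a.re • (1 : ℂ) + a.im • Complex.I by
      simp [Complex.re_add_im], map_add, map_smul, map_smul]
  simp only [leftVelocity_eq, h]
  fin_cases k <;> simp
  ring

/-- The chain rule for `∂` and a holomorphic inner function. -/
theorem wirt_comp {h g : ℂ → ℂ} {u : ℂ} (hh : DifferentiableAt ℝ h (g u))
    (hg : DifferentiableAt ℂ g u) :
    wirt (-Complex.I) (fun t => h (g t)) u = deriv g u * wirt (-Complex.I) h (g u) := by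
  have hc : HasFDerivAt (fun t => h (g t)) _ u :=
    hh.hasFDerivAt.comp u (hg.hasFDerivAt.restrictScalars ℝ)
  have hgv (v : ℂ) : fderiv ℂ g u v = v * deriv g u := by
    rw [fderiv_eq_smul_deriv, smul_eq_mul]
  simp only [wirt, hc.fderiv, ContinuousLinearMap.comp_apply,
    ContinuousLinearMap.coe_restrictScalars', hgv]
  rw [fderiv_apply_mul_add (1 * deriv g u), fderiv_apply_mul_add (Complex.I * deriv g u)]
  simp
  linear_combination (1 / 2) * (fderiv ℝ h (g u) 1 - Complex.I * fderiv ℝ h (g u) Complex.I)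
    * Complex.re_add_im (deriv g u)
    + (1 / 2) * (deriv g u).im * fderiv ℝ h (g u) Complex.I * Complex.I_mul_I

/-- `F`, `N` is obtained from `G`, `N'` by the change of parameter `g` on `U`. -/
structure IsReparametrization (F G : ℂ → NilGroup) (N N' : ℂ → Fin 3 → ℝ) (g : ℂ → ℂ)
    (U V : Set ℂ) : Prop where
  left : IsConformalParametrization F N U
  right : IsConformalParametrization G N' V
  smooth : ContDiffOn ℝ ∞ g U
  mapsTo : Set.MapsTo g U V
  map_eq : ∀ t ∈ U, F t = G (g t)
  normal_eq : ∀ t ∈ U, N t = N' (g t)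

namespace IsReparametrization

variable {F G : ℂ → NilGroup} {N N' : ℂ → Fin 3 → ℝ} {g : ℂ → ℂ} {U V : Set ℂ} {u : ℂ}

theorem differentiableAt_real (h : IsReparametrization F G N N' g U V) (hu : u ∈ U) :
    DifferentiableAt ℝ g u :=
  (h.smooth.contDiffAt (h.left.isOpen.mem_nhds hu)).differentiableAt (by simp)

theorem leftVelocity_eq_comp (h : IsReparametrization F G N N' g U V) (hu : u ∈ U) (v : ℂ) :
    leftVelocity F u v = leftVelocity G (g u) (fderiv ℝ g u v) := by
  have hG := (h.right.contDiffAt (h.mapsTo hu)).differentiableAt (by simp)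
  have hev : (fun t => (F t).coords) =ᶠ[nhds u] fun t => (G (g t)).coords := by
    filter_upwards [h.left.isOpen.mem_nhds hu] with t ht
    rw [h.map_eq t ht]
  have hc : HasFDerivAt (fun t => (G (g t)).coords) _ u :=
    hG.hasFDerivAt.comp u (h.differentiableAt_real hu).hasFDerivAt
  rw [leftVelocity, leftVelocity, h.map_eq u hu, hev.fderiv_eq, hc.fderiv]
  rfl

/-- Comparing the two conformal metrics, the real partials a, b of g are orthogonal and of equal
length, and the common normal makes (a, b) positively oriented. Hence b = ia, the Cauchy–Riemann
equation. -/
theorem differentiableAt (h : IsReparametrization F G N N' g U V) (hu : u ∈ U) :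
    DifferentiableAt ℂ g u := by
  refine differentiableAt_complex_iff_differentiableAt_real.2 ⟨h.differentiableAt_real hu, ?_⟩
  obtain ⟨E, hE, -, h11, h22, h12⟩ := h.left.exists_conformal_factor hu
  obtain ⟨e, he, -, k11, k22, k12⟩ := h.right.exists_conformal_factor (h.mapsTo hu)
  have hpos := h.left.pos u hu
  have kpos := h.right.pos (g u) (h.mapsTo hu)
  rw [h.normal_eq u hu] at hpos
  rw [h.leftVelocity_eq_comp hu, h.leftVelocity_eq_comp hu] at hpos h12
  rw [h.leftVelocity_eq_comp hu] at h11 h22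
  set a := fderiv ℝ g u 1
  set b := fderiv ℝ g u Complex.I
  simp only [Matrix.vec3_dotProduct, leftVelocity_apply G (g u) a, leftVelocity_apply G (g u) b,
    cross_apply, Matrix.cons_val] at h11 h22 h12 k11 k22 k12 hpos kpos
  set X := leftVelocity G (g u) 1
  set Y := leftVelocity G (g u) Complex.I
  set n := N' (g u)
  have q1 : e * (a.re ^ 2 + a.im ^ 2) = E := by
    linear_combination h11 - a.re ^ 2 * k11 - a.im ^ 2 * k22 - 2 * a.re * a.im * k12
  have q2 : e * (b.re ^ 2 + b.im ^ 2) = E := by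
    linear_combination h22 - b.re ^ 2 * k11 - b.im ^ 2 * k22 - 2 * b.re * b.im * k12
  have q3 : a.re * b.re + a.im * b.im = 0 := by
    apply (mul_eq_zero.1 (_ : e * (a.re * b.re + a.im * b.im) = 0)).resolve_left he.ne'
    linear_combination h12 - a.re * b.re * k11 - a.im * b.im * k22
      - (a.re * b.im + a.im * b.re) * k12
  have q4 : 0 < a.re * b.im - a.im * b.re := by
    refine pos_of_mul_pos_left (lt_of_lt_of_eq hpos ?_) kpos.le
    ring
  have q5 : a.re ^ 2 + a.im ^ 2 = b.re ^ 2 + b.im ^ 2 :=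
    mul_left_cancel₀ he.ne' (q1.trans q2.symm)
  have q6 : a.re * b.im - a.im * b.re = a.re ^ 2 + a.im ^ 2 := by
    refine (pow_left_inj₀ q4.le (by positivity) two_ne_zero).1 ?_
    linear_combination -(a.re ^ 2 + a.im ^ 2) * q5 - (a.re * b.re + a.im * b.im) * q3
  -- The left side is |b − ia|².
  have q7 : (b.re + a.im) ^ 2 + (b.im - a.re) ^ 2 = 0 := by
    linear_combination -q5 - 2 * q6
  obtain ⟨q8, q9⟩ := (add_eq_zero_iff_of_nonneg (sq_nonneg _) (sq_nonneg _)).1 q7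
  rw [sq_eq_zero_iff] at q8 q9
  apply Complex.ext
  · simp; linarith
  · simp; linarith

theorem differentiableOn (h : IsReparametrization F G N N' g U V) : DifferentiableOn ℂ g U :=
  fun _ hu => (h.differentiableAt hu).differentiableWithinAt

theorem zComp_eq (h : IsReparametrization F G N N' g U V) (hu : u ∈ U) (k : Fin 3) :
    zComp F u k = deriv g u * zComp G (g u) k := by
  have hg (v : ℂ) : fderiv ℝ g u v = v * deriv g u := by
    rw [((h.differentiableAt hu).hasFDerivAt.restrictScalars ℝ).fderiv,
      ContinuousLinearMap.coe_restrictScalars', fderiv_eq_smul_deriv, smul_eq_mul]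
  simp only [zComp, h.leftVelocity_eq_comp hu, hg]
  rw [leftVelocity_apply G (g u) (1 * deriv g u),
    leftVelocity_apply G (g u) (Complex.I * deriv g u)]
  simp
  linear_combination (1 / 2) *
    (leftVelocity G (g u) 1 k - Complex.I * leftVelocity G (g u) Complex.I k)
    * Complex.re_add_im (deriv g u)
    + (1 / 2) * (deriv g u).im * leftVelocity G (g u) Complex.I k * Complex.I_mul_I

/-- Differentiating Z^F = g′ · (Z^G ∘ g) yields a g″ term along Z^G, which the normal annihilates;
every other term carries (g′)². -/
theorem hopfCoeff_eq (h : IsReparametrization F G N N' g U V) (hu : u ∈ U) :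
    hopfCoeff F N u = hopfCoeff G N' (g u) * deriv g u ^ 2 := by
  have dg := h.differentiableAt hu
  have dg' : DifferentiableAt ℝ (deriv g) u :=
    ((h.differentiableOn.deriv h.left.isOpen).differentiableAt
      (h.left.isOpen.mem_nhds hu)).restrictScalars ℝ
  have dZ (k : Fin 3) : DifferentiableAt ℝ (fun t => zComp G t k) (g u) :=
    (contDiffAt_zComp (h.right.contDiffAt (h.mapsTo hu)) k).differentiableAt (by simp)
  have hw (k : Fin 3) : wirt (-Complex.I) (fun t => zComp F t k) u =
      wirt (-Complex.I) (deriv g) u * zComp G (g u) k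
        + deriv g u * (deriv g u * wirt (-Complex.I) (fun t => zComp G t k) (g u)) := by
    have hev : (fun t => zComp F t k) =ᶠ[nhds u] fun t => deriv g t * zComp G (g t) k := by
      filter_upwards [h.left.isOpen.mem_nhds hu] with t ht
      exact h.zComp_eq ht k
    have dc : DifferentiableAt ℝ (fun t => zComp G (g t) k) u :=
      (dZ k).comp u (dg.restrictScalars ℝ)
    rw [hev.wirt_eq, wirt_mul dg' dc, wirt_comp (dZ k) dg]
  have hn := (h.right.isConformalFrame (h.mapsTo hu)).1.nz
  have hN : IsConformalParametrization.normalC N u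
      = IsConformalParametrization.normalC N' (g u) := by
    unfold IsConformalParametrization.normalC
    rw [h.normal_eq u hu]
  rw [IsConformalParametrization.hopfCoeff_eq, IsConformalParametrization.hopfCoeff_eq, hN]
  simp only [hw, Matrix.vec3_dotProduct, NilGroup.connection_eq, Matrix.cons_val,
    h.zComp_eq hu] at hn ⊢
  linear_combination wirt (-Complex.I) (deriv g) u * hn

theorem abreschCoeff_eq (h : IsReparametrization F G N N' g U V) (hu : u ∈ U) (H : ℝ) :
    abreschCoeff F N H u = abreschCoeff G N' H (g u) * deriv g u ^ 2 := by
  rw [abreschCoeff, abreschCoeff, h.hopfCoeff_eq hu, h.zComp_eq hu]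
  ring

end IsReparametrization

/-! ### Surfaces -/

section Surfaces

variable {M : Type*} [TopologicalSpace M] [ChartedSpace ℂ M]
  {f : M → NilGroup} {n : M → Fin 3 → ℝ}

theorem IsConformalParameter.isConformalParametrization (hf : IsNilImmersion f)
    (hn : IsNilUnitNormal f n) {z : OpenPartialHomeomorph M ℂ} (hz : IsConformalParameter f n z) :
    IsConformalParametrization (f ∘ z.symm) (n ∘ z.symm) z.target := by
  have hs : ContMDiffOn 𝓘(ℝ, ℂ) 𝓘(ℝ, ℂ) ∞ z.symm z.target :=
    contMDiffOn_symm_of_mem_maximalAtlas hz.1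
  refine ⟨z.open_target, (hf.1.comp_contMDiffOn hs).contDiffOn, fun u _ => hn.2.1 _,
    fun u hu v => ?_, fun u hu => (hz.2 u hu).1, fun u hu => (hz.2 u hu).2⟩
  have hsu : MDifferentiableAt 𝓘(ℝ, ℂ) 𝓘(ℝ, ℂ) z.symm u :=
    (hs.contMDiffAt (z.open_target.mem_nhds hu)).mdifferentiableAt (by simp)
  have hfu := (hf.1 (z.symm u)).mdifferentiableAt (by simp)
  have hc := mfderiv_comp u hfu hsu
  have h0 := hn.2.2 (z.symm u) (mfderiv 𝓘(ℝ, ℂ) 𝓘(ℝ, ℂ) z.symm u v)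
  rw [leftVelocity]
  rw [mfderiv_eq_fderiv] at hc
  have hv : fderiv ℝ (fun t => ((f ∘ z.symm) t).coords) u v = mfderiv 𝓘(ℝ, ℂ) 𝓘(ℝ, Fin 3 → ℝ)
      (fun q => (f q).coords) (z.symm u) (mfderiv 𝓘(ℝ, ℂ) 𝓘(ℝ, ℂ) z.symm u v) :=
    DFunLike.congr_fun hc v
  rw [hv]
  exact h0

theorem IsConformalParametrization.mono {F : ℂ → NilGroup} {N : ℂ → Fin 3 → ℝ} {U V : Set ℂ}
    (h : IsConformalParametrization F N V) (hU : IsOpen U) (hUV : U ⊆ V) :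
    IsConformalParametrization F N U :=
  ⟨hU, h.smooth.mono hUV, fun u hu => h.unit u (hUV hu), fun u hu => h.orth u (hUV hu),
    fun u hu => h.conf u (hUV hu), fun u hu => h.pos u (hUV hu)⟩

theorem IsConformalParameter.isReparametrization (hf : IsNilImmersion f)
    (hn : IsNilUnitNormal f n) {z w : OpenPartialHomeomorph M ℂ}
    (hz : IsConformalParameter f n z) (hw : IsConformalParameter f n w) :
    IsReparametrization (f ∘ z.symm) (f ∘ w.symm) (n ∘ z.symm) (n ∘ w.symm) (w ∘ z.symm)
      (z.symm.trans w).source w.target := by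
  have hsub : (z.symm.trans w).source ⊆ z.target := by
    rw [OpenPartialHomeomorph.trans_source]
    exact Set.inter_subset_left
  have hmem : ∀ t ∈ (z.symm.trans w).source, z.symm t ∈ w.source := fun t ht => by
    rw [OpenPartialHomeomorph.trans_source] at ht
    exact ht.2
  refine ⟨(hz.isConformalParametrization hf hn).mono (z.symm.trans w).open_source hsub,
    hw.isConformalParametrization hf hn, ?_, fun t ht => w.map_source (hmem t ht),
    fun t ht => ?_, fun t ht => ?_⟩
  · exact ((contMDiffOn_of_mem_maximalAtlas hw.1).comp
      ((contMDiffOn_symm_of_mem_maximalAtlas hz.1).mono hsub) hmem).contDiffOn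
  · simp [w.left_inv (hmem t ht)]
  · simp [w.left_inv (hmem t ht)]

end Surfaces

theorem mainTheorem4 {M : Type*} [TopologicalSpace M] [ChartedSpace ℂ M]
    [IsManifold 𝓘(ℝ, ℂ) ∞ M] (f : M → NilGroup) (n : M → Fin 3 → ℝ) (H : ℝ)
    (hf : IsNilImmersion f) (hn : IsNilUnitNormal f n) (hH : HasConstMeanCurvature f n H) :
    -- the coefficient of the differential is holomorphic in every conformal parameter
    (∀ z : OpenPartialHomeomorph M ℂ, IsConformalParameter f n z →
      DifferentiableOn ℂ (abreschCoeff (f ∘ z.symm) (n ∘ z.symm) H) z.target ∧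
      ∀ ψ₁ ψ₂ : ℂ → ℂ, IsGeneratingSpinor (f ∘ z.symm) z.target ψ₁ ψ₂ →
        DifferentiableOn ℂ
          (fun u => hopfCoeff (f ∘ z.symm) (n ∘ z.symm) u
            + (ψ₁ u * conj (ψ₂ u)) ^ 2 / (2 * (H : ℂ) + Complex.I)) z.target) ∧
    -- changes of conformal parameter are holomorphic, and the coefficients transform as those of a
    -- quadratic differential
    (∀ z w : OpenPartialHomeomorph M ℂ,
      IsConformalParameter f n z → IsConformalParameter f n w →
      DifferentiableOn ℂ (w ∘ z.symm) (z.symm.trans w).source ∧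
      ∀ u ∈ (z.symm.trans w).source,
        abreschCoeff (f ∘ z.symm) (n ∘ z.symm) H u =
          abreschCoeff (f ∘ w.symm) (n ∘ w.symm) H (w (z.symm u))
            * deriv (w ∘ z.symm) u ^ 2) := by

  refine ⟨fun z hz => ?_, fun z w hz hw => ?_⟩
  · have hd := (hz.isConformalParametrization hf hn).differentiableOn_abreschCoeff (hH z hz.1)
    refine ⟨hd, fun ψ₁ ψ₂ hψ => hd.congr fun u hu => ?_⟩
    -- Only the spinor formula for Z₃ matters.
    rw [abreschCoeff, (hψ u hu).2.2]
  · have h := hz.isReparametrization hf hn hw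
    exact ⟨h.differentiableOn, fun u hu => h.abreschCoeff_eq hu H⟩
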